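/- Let $\mathbf M$ be a structure with (nonempty) universe $M$, either a metric structure of continuous first-order logic (a complete metric space of diameter at most $1$ with uniformly continuous function symbols and $[0,1]$-valued predicate symbols) or a structure of classical first-order logic, in which case the value of a formula is $0$ where it is true and $1$ where it is false. Let $\varphi(x,y)$ be a formula, where $x,y$ are disjoint finite tuples of variables, and let $\tilde\varphi(y,x)=\varphi(x,y)$. We say that $\varphi$ is \emph{stable in} $\mathbf M$ if for all sequences $(a_n)$, $(b_m)$ of tuples in $M$, $$\lim_n\lim_m \varphi(a_n,b_m)=\lim_m\lim_n\varphi(a_n,b_m)$$ as soon as both iterated limits exist. The $\varphi$-type over $M$ of a tuple $a$ in an elementary extension of $\mathbf M$ is $p=\operatorname{tp}_\varphi(a/M)\colon b\mapsto \varphi(p,b):=\varphi(a,b)$, for $b$ in $M$ (in classical logic, equivalently the set of instances $\varphi(x,b)$ with $\varphi(a,b)$ true), and $S_\varphi(M)$ is the set of all of these. A \emph{$\varphi$-predicate over $M$} is a function $S_\varphi(M)\to[0,1]$ which is a uniform limit of finite continuous combinations of the functions $\varphi^b\colon p\mapsto\varphi(p,b)$, $b$ in $M$. In classical logic, a \emph{$\varphi$-formula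 over $M$} is a Boolean combination of instances $\varphi(x,b)$, $b$ in $M$. Thus a $\tilde\varphi$-predicate over $M$ is a function $\psi$ on $S_{\tilde\varphi}(M)$, and we write $\psi(b)=\psi(\operatorname{tp}_{\tilde\varphi}(b/M))$ for $b$ in $M$. \textbf{Theorem.} Suppose that $\varphi(x,y)$ is stable in $\mathbf M$. (1) (Continuous logic.) For every $p\in S_\varphi(M)$ there is a unique $\tilde\varphi$-predicate $\psi(y)$ over $M$ which defines $p$, that is, $\varphi(p,b)=\psi(b)$ for all $b$ in $M$. (2) (Classical logic.) For every $p\in S_\varphi(M)$ there is a $\tilde\varphi$-formula $\psi(y)$ over $M$ which defines $p$, that is, $\varphi(x,b)\in p$ if and only if $\mathbf M\models\psi(b)$, for all $b$ in $M$. It is unique up to equivalence modulo the elementary diagram of $\mathbf M$. -/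

import Mathlib

open Filter Topology unitInterval

universe u v w w' x y

/-! ### Iterated limits and stability of a two-place function -/

/-- The iterated limit `lim_n lim_m f n m` exists and equals `l`. -/
def HasIteratedLimit (f : ℕ → ℕ → I) (l : I) : Prop :=
  ∃ g : ℕ → I, (∀ n, Tendsto (fun m => f n m) atTop (𝓝 (g n))) ∧ Tendsto g atTop (𝓝 l)

/-- The double limit condition: for all sequences `a n`, `b m`, the iterated limits
`lim_n lim_m f (a n) (b m)` and `lim_m lim_n f (a n) (b m)` agree as soon as both exist. -/
def DoubleLimitProperty {A : Type x} {B : Type y} (f : A → B → I) : Prop :=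
  ∀ (a : ℕ → A) (b : ℕ → B) (l l' : I),
    HasIteratedLimit (fun n m => f (a n) (b m)) l →
    HasIteratedLimit (fun m n => f (a n) (b m)) l' → l = l'

/-! ### Continuous first-order logic -/

/-- A (single-sorted) signature for continuous logic: function and predicate symbols with their
arities, each with a modulus of uniform continuity. -/
structure MetricLanguage where
  /-- function symbols of each arity -/
  Functions : ℕ → Type u
  /-- predicate symbols of each arity -/
  Relations : ℕ → Type v
  /-- moduli of uniform continuity of the function symbols -/
  funModulus : ∀ {n : ℕ}, Functions n → ℝ → ℝ
  funModulus_pos : ∀ {n : ℕ} (f : Functions n) (ε : ℝ), 0 < ε → 0 < funModulus f ε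
  /-- moduli of uniform continuity of the predicate symbols -/
  relModulus : ∀ {n : ℕ}, Relations n → ℝ → ℝ
  relModulus_pos : ∀ {n : ℕ} (R : Relations n) (ε : ℝ), 0 < ε → 0 < relModulus R ε

namespace MetricLanguage

/-- Terms with variables in `α`. -/
inductive Term (L : MetricLanguage.{u, v}) (α : Type x) : Type (max u x)
  | var (i : α) : Term L α
  | func {n : ℕ} (f : L.Functions n) (ts : Fin n → Term L α) : Term L α

/-- Formulas with free variables in `α` and `n` further variables available for quantification.
The connectives are all continuous functions `[0,1]^k → [0,1]`, the quantifiers are `inf` and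
`sup` (they bind the last of the `n + 1` variables), and the metric is a predicate. -/
inductive BoundedFormula (L : MetricLanguage.{u, v}) (α : Type x) : ℕ → Type (max u v x)
  | dist {n : ℕ} (s t : L.Term (α ⊕ Fin n)) : BoundedFormula L α n
  | rel {n k : ℕ} (R : L.Relations k) (ts : Fin k → L.Term (α ⊕ Fin n)) : BoundedFormula L α n
  | conn {n k : ℕ} (c : C(Fin k → I, I)) (φs : Fin k → BoundedFormula L α n) :
      BoundedFormula L α n
  | inf {n : ℕ} (φ : BoundedFormula L α (n + 1)) : BoundedFormula L α n
  | sup {n : ℕ} (φ : BoundedFormula L α (n + 1)) : BoundedFormula L α n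

/-- Formulas of continuous logic with free variables in `α`. -/
abbrev Formula (L : MetricLanguage.{u, v}) (α : Type x) := L.BoundedFormula α 0

/-- Renaming of the variables of a term. -/
def Term.relabel {L : MetricLanguage.{u, v}} {α : Type x} {β : Type y} (g : α → β) :
    L.Term α → L.Term β
  | .var i => .var (g i)
  | .func f ts => .func f (fun i => (ts i).relabel g)

/-- Renaming of the free variables of a formula. -/
def BoundedFormula.relabel {L : MetricLanguage.{u, v}} {α : Type x} {β : Type y} (g : α → β) :
    {n : ℕ} → L.BoundedFormula α n → L.BoundedFormula β n
  | _, .dist s t => .dist (s.relabel (Sum.map g id)) (t.relabel (Sum.map g id))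
  | _, .rel R ts => .rel R (fun i => (ts i).relabel (Sum.map g id))
  | _, .conn c φs => .conn c (fun i => (φs i).relabel g)
  | _, .inf φ => .inf (φ.relabel g)
  | _, .sup φ => .sup (φ.relabel g)

/-- An `L`-structure on a metric space: the metric is bounded by `1`, the function symbols are
interpreted by functions, the predicate symbols by `[0,1]`-valued functions, all of them
respecting the moduli of uniform continuity (for the maximum metric on tuples). Completeness of
the metric space is assumed separately. -/
class Structure (L : MetricLanguage.{u, v}) (M : Type w) [MetricSpace M] where
  dist_le_one : ∀ a b : M, Dist.dist a b ≤ 1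
  /-- interpretation of the function symbols -/
  funMap : ∀ {n : ℕ}, L.Functions n → (Fin n → M) → M
  /-- interpretation of the predicate symbols -/
  relMap : ∀ {n : ℕ}, L.Relations n → (Fin n → M) → I
  funMap_unif : ∀ {n : ℕ} (f : L.Functions n) (ε : ℝ), 0 < ε → ∀ a b : Fin n → M,
    Dist.dist a b < L.funModulus f ε → Dist.dist (funMap f a) (funMap f b) ≤ ε
  relMap_unif : ∀ {n : ℕ} (R : L.Relations n) (ε : ℝ), 0 < ε → ∀ a b : Fin n → M,
    Dist.dist a b < L.relModulus R ε → Dist.dist (relMap R a) (relMap R b) ≤ ε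

section Semantics

variable {L : MetricLanguage.{u, v}} {M : Type w} [MetricSpace M] [L.Structure M]

/-- The value of a term under an assignment. -/
def Term.realize {α : Type x} (e : α → M) : L.Term α → M
  | .var i => e i
  | .func f ts => Structure.funMap f (fun i => (ts i).realize e)

/-- The truth value in `[0,1]` of a formula under an assignment. -/
noncomputable def BoundedFormula.value {α : Type x} (e : α → M) :
    {n : ℕ} → L.BoundedFormula α n → (Fin n → M) → I
  | _, .dist s t, xs =>
      ⟨Dist.dist (s.realize (Sum.elim e xs)) (t.realize (Sum.elim e xs)),
        dist_nonneg, Structure.dist_le_one L _ _⟩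
  | _, .rel R ts, xs => Structure.relMap R (fun i => (ts i).realize (Sum.elim e xs))
  | _, .conn c φs, xs => c (fun i => (φs i).value e xs)
  | _, .inf φ, xs => ⨅ a : M, φ.value e (Fin.snoc xs a)
  | _, .sup φ, xs => ⨆ a : M, φ.value e (Fin.snoc xs a)

/-- The value of a formula under an assignment of its free variables. -/
noncomputable def Formula.val {α : Type x} (φ : L.Formula α) (e : α → M) : I :=
  BoundedFormula.value e φ Fin.elim0

end Semantics

/-- Elementary embeddings: maps which preserve the values of all formulas. -/
structure ElementaryEmbedding (L : MetricLanguage.{u, v}) (M : Type w) (N : Type w')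
    [MetricSpace M] [L.Structure M] [MetricSpace N] [L.Structure N] where
  /-- the underlying map -/
  toFun : M → N
  val_comp : ∀ (n : ℕ) (φ : L.Formula (Fin n)) (e : Fin n → M),
    φ.val (toFun ∘ e) = φ.val e

section Types

variable {L : MetricLanguage.{u, v}} {α : Type x} {β : Type y}

/-- `φ̃(y,x) = φ(x,y)`. -/
def Formula.swap (φ : L.Formula (α ⊕ β)) : L.Formula (β ⊕ α) :=
  BoundedFormula.relabel Sum.swap φ

variable (M : Type w) [MetricSpace M] [L.Structure M]

/-- The formula `φ(x,y)` is stable in the structure `M`. -/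
def Formula.IsStableIn (φ : L.Formula (α ⊕ β)) : Prop :=
  DoubleLimitProperty (fun (a : α → M) (b : β → M) => φ.val (Sum.elim a b))

/-- The set `S_φ(M)` of all `φ`-types over `M`: the functions `b ↦ φ(a,b)` on tuples `b` of `M`,
where `a` is a tuple in an elementary extension `N` of `M`. By the downward
Löwenheim–Skolem theorem the universe in which `N` ranges makes no difference, as long as it is
at least the one used here. -/
def Formula.types (φ : L.Formula (α ⊕ β)) : Set ((β → M) → I) :=
  {p | ∃ (N : Type (max u v w)) (_ : MetricSpace N) (_ : CompleteSpace N) (_ : L.Structure N)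
    (j : L.ElementaryEmbedding M N) (a : α → N),
    p = fun b => φ.val (Sum.elim a (j.toFun ∘ b))}

/-- The lift of a structure to a larger universe. -/
instance Structure.ulift : L.Structure (ULift.{w', w} M) where
  dist_le_one a b := Structure.dist_le_one L a.down b.down
  funMap f a := ⟨Structure.funMap f (fun i => (a i).down)⟩
  relMap R a := Structure.relMap R (fun i => (a i).down)
  funMap_unif f ε hε a b h := Structure.funMap_unif f ε hε _ _ h
  relMap_unif R ε hε a b h := Structure.relMap_unif R ε hε _ _ h

variable {M}

theorem Term.realize_ulift {γ : Type x} (e : γ → M) (t : L.Term γ) :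
    t.realize (fun i => (ULift.up (e i) : ULift.{w', w} M)) = ULift.up (t.realize e) := by
  induction t with
  | var i => rfl
  | func f ts ih => simp only [Term.realize, ih]; rfl

theorem BoundedFormula.value_ulift {γ : Type x} (e : γ → M) {n : ℕ} (φ : L.BoundedFormula γ n)
    (xs : Fin n → M) :
    φ.value (fun i => (ULift.up (e i) : ULift.{w', w} M)) (fun i => ULift.up (xs i))
      = φ.value e xs := by
  have key : ∀ {n : ℕ} (xs : Fin n → M),
      Sum.elim (fun i => (ULift.up (e i) : ULift.{w', w} M)) (fun i => ULift.up (xs i))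
        = fun i => ULift.up (Sum.elim e xs i) := by
    intro n xs; funext i; cases i <;> rfl
  have snoc : ∀ {n : ℕ} (xs : Fin n → M) (a : M),
      (Fin.snoc (fun i => (ULift.up (xs i) : ULift.{w', w} M)) (ULift.up a) :
          Fin (n + 1) → ULift.{w', w} M)
        = fun i => ULift.up ((Fin.snoc xs a : Fin (n + 1) → M) i) := by
    intro n xs a; funext i
    refine Fin.lastCases ?_ (fun i => ?_) i <;> simp
  induction φ with
  | dist s t => simp only [BoundedFormula.value, key, Term.realize_ulift]; rfl
  | rel R ts => simp only [BoundedFormula.value, key, Term.realize_ulift]; rfl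
  | conn c φs ih => simp only [BoundedFormula.value, ih]
  | inf φ ih =>
    simp only [BoundedFormula.value]
    rw [← Equiv.ulift.symm.iInf_comp]
    exact iInf_congr fun a => by rw [← ih, ← snoc]; rfl
  | sup φ ih =>
    simp only [BoundedFormula.value]
    rw [← Equiv.ulift.symm.iSup_comp]
    exact iSup_congr fun a => by rw [← ih, ← snoc]; rfl

/-- A structure is an elementary extension of itself, up to a lift of universe. -/
def ElementaryEmbedding.up (L : MetricLanguage.{u, v}) (M : Type w) [MetricSpace M]
    [L.Structure M] : L.ElementaryEmbedding M (ULift.{w', w} M) where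
  toFun := ULift.up
  val_comp n φ e := by
    have h := BoundedFormula.value_ulift.{u, v, w, w', 0} e φ Fin.elim0
    rw [← show (Fin.elim0 : Fin 0 → ULift.{w', w} M) = fun i => ULift.up (Fin.elim0 i) from
      Subsingleton.elim _ _] at h
    exact h

/-- The type `tp_φ(a/M)` of a tuple `a` of `M` itself. -/
noncomputable def Formula.realizedType [CompleteSpace M] (φ : L.Formula (α ⊕ β)) (a : α → M) :
    φ.types M :=
  ⟨fun b => φ.val (Sum.elim a b), ULift.{max u v, w} M, inferInstance, inferInstance,
    inferInstance, ElementaryEmbedding.up L M, fun i => ULift.up (a i), by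
      funext b
      have h := BoundedFormula.value_ulift.{u, v, w, max u v} (Sum.elim a b) φ Fin.elim0
      rw [← show (Fin.elim0 : Fin 0 → ULift.{max u v, w} M) = fun i => ULift.up (Fin.elim0 i)
        from Subsingleton.elim _ _, show (fun i => (ULift.up (Sum.elim a b i) :
          ULift.{max u v, w} M)) = Sum.elim (fun i => ULift.up (a i)) (ULift.up ∘ b) by
          funext i; cases i <;> rfl] at h
      exact h.symm⟩

/-- `φ`-predicates over `M`: functions on `S_φ(M)` which are uniform limits of finite continuous
combinations of the functions `φ^b : p ↦ φ(p,b)`, for `b` in `M`. -/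
def Formula.IsPredicate (φ : L.Formula (α ⊕ β)) (ψ : φ.types M → I) : Prop :=
  ∀ ε : ℝ, 0 < ε → ∃ (k : ℕ) (b : Fin k → β → M) (c : C(Fin k → I, I)),
    ∀ p : φ.types M, Dist.dist (ψ p) (c (fun i => p.1 (b i))) ≤ ε

/-- The `φ̃`-predicate `ψ(y)` over `M` defines the `φ`-type `p`: `φ(p,b) = ψ(b)` for all `b` in
`M`, where `ψ(b)` is the value of `ψ` at `tp_φ̃(b/M)`. -/
def Formula.Defines [CompleteSpace M] (φ : L.Formula (α ⊕ β)) (ψ : φ.swap.types M → I)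
    (p : φ.types M) : Prop :=
  ∀ b : β → M, p.1 b = ψ (φ.swap.realizedType b)

end Types

end MetricLanguage

/-! ### Classical first-order logic -/

namespace ClassicalLocalTypes

open FirstOrder FirstOrder.Language

variable {L : FirstOrder.Language.{u, v}} {α : Type x} {β : Type y}

open Classical in
/-- Truth values: true is `0` and false is `1`. -/
noncomputable def truthValue (P : Prop) : I := if P then 0 else 1

/-- The classical formula `φ(x,y)` is stable in the structure `M`. -/
def IsStableIn (φ : L.Formula (α ⊕ β)) (M : Type w) [L.Structure M] : Prop :=
  DoubleLimitProperty (fun (a : α → M) (b : β → M) => truthValue (φ.Realize (Sum.elim a b)))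

/-- The set `S_φ(M)` of all `φ`-types over `M`. The type of a tuple `a` in an elementary extension
`N` of `M` is the set of all instances `φ(x,b)`, with `b` in `M`, such that `φ(a,b)` holds; an
instance `φ(x,b)` is represented by the tuple `b`. -/
def types (φ : L.Formula (α ⊕ β)) (M : Type w) [L.Structure M] : Set (Set (β → M)) :=
  {p | ∃ (N : Type (max u v w)) (_ : L.Structure N) (j : M ↪ₑ[L] N) (a : α → N),
    p = {b | φ.Realize (Sum.elim a (j ∘ b))}}

/-- The instance `φ(x,b)` of `φ(x,y)`, a formula with parameters in `M`. -/
def inst {M : Type w} (φ : L.Formula (α ⊕ β)) (b : β → M) : L[[M]].Formula α :=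
  BoundedFormula.subst ((L.lhomWithConstants M).onFormula φ)
    (Sum.elim Term.var (fun i => (L.con (b i)).term))

/-- `φ`-formulas over `M`: Boolean combinations of instances of `φ` over `M`. -/
inductive IsLocalFormula {M : Type w} (φ : L.Formula (α ⊕ β)) : L[[M]].Formula α → Prop
  | inst (b : β → M) : IsLocalFormula φ (inst φ b)
  | bot : IsLocalFormula φ ⊥
  | not {ψ : L[[M]].Formula α} : IsLocalFormula φ ψ → IsLocalFormula φ (Formula.not ψ)
  | inf {ψ χ : L[[M]].Formula α} :
      IsLocalFormula φ ψ → IsLocalFormula φ χ → IsLocalFormula φ (ψ ⊓ χ)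
  | sup {ψ χ : L[[M]].Formula α} :
      IsLocalFormula φ ψ → IsLocalFormula φ χ → IsLocalFormula φ (ψ ⊔ χ)

/-- The formula `ψ(y)` over `M` defines the `φ`-type `p`: an instance `φ(x,b)` with `b` in `M`
belongs to `p` if and only if `ψ(b)` holds. -/
def Defines {M : Type w} [L.Structure M] (ψ : L[[M]].Formula β) (p : Set (β → M)) : Prop :=
  ∀ b : β → M, b ∈ p ↔ ψ.Realize b

end ClassicalLocalTypes

/-! ### The double limit criterion -/

/-! By elementarity a type `p` is finitely satisfiable in `M`: `b ↦ φ(p,b)` is a pointwise limit of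
functions `φ(a,·)` with `a` in `M`. The core is a double limit argument in the style of Grothendieck
(`DoubleLimitProperty.exists_finset_dist_le`): under stability, finitely many values `φ(a,b)`, each
known up to some `δ`, determine `φ(p,b)` up to `ε`. Otherwise there are sequences `a_n`, `b_n`,
`b'_n` such that `φ(a_n,·)` is ever closer to `p` at the earlier `b`'s, the earlier `a`'s hardly
tell `b_n` from `b'_n`, and yet `p` separates these two by `ε`. Along subsequences the double limit
condition gives `p(b_n)` and `p(b'_n)` the same limit, a contradiction.

In continuous logic an infimal convolution turns this dependence into a continuous combination of
the `φ(a_i,b)`. Realized types are dense in `S_φ̃(M)`, so these approximations converge uniformly on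
the whole space, and two predicates that agree on `M` coincide by continuity. In classical logic `ε
= 1/2` already makes `p` a finite union of truth patterns of instances. Uniqueness holds because the
universal closure of `ψ ↔ χ` lies in the elementary diagram. -/

namespace DoubleLimitProperty

variable {A : Type x} {B : Type y} {f : A → B → I} {p : B → I}

/-- If `f` has the double limit property, a pointwise limit `p` of functions `f a` depends, up to
`ε`, only on finitely many values `f a b`, each of them up to some `δ`. -/
theorem exists_finset_dist_le (hf : DoubleLimitProperty f)
    (hp : ∀ (s : Finset B) (ε : ℝ), 0 < ε → ∃ a, ∀ b ∈ s, dist (f a b) (p b) < ε)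
    {ε : ℝ} (hε : 0 < ε) :
    ∃ (s : Finset A) (δ : ℝ), 0 < δ ∧
      ∀ b b', (∀ a ∈ s, dist (f a b) (f a b') ≤ δ) → dist (p b) (p b') ≤ ε := by
  classical
  by_contra! hcon
  -- A term of the sequence is `(n, a, b, b')`. The strictly increasing counter `n` carries the
  -- tolerance `1 / (n + 1)`, so the errors tend to `0`.
  obtain ⟨g, hg, hrel⟩ := exists_seq_of_forall_finset_exists
    (fun z : ℕ × A × B × B => ε < dist (p z.2.2.1) (p z.2.2.2))
    (fun z z' => z.1 < z'.1 ∧ dist (f z.2.1 z'.2.2.1) (f z.2.1 z'.2.2.2) ≤ 1 / ((z'.1 : ℝ) + 1) ∧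
      dist (f z'.2.1 z.2.2.1) (p z.2.2.1) < 1 / ((z'.1 : ℝ) + 1) ∧
      dist (f z'.2.1 z.2.2.2) (p z.2.2.2) < 1 / ((z'.1 : ℝ) + 1)) (by
    intro s _
    obtain ⟨n, hn⟩ : ∃ n : ℕ, ∀ z ∈ s, z.1 < n :=
      ⟨s.sup Prod.fst + 1, fun z hz => Nat.lt_succ_of_le (Finset.le_sup (f := Prod.fst) hz)⟩
    obtain ⟨b, b', hb, hlt⟩ := hcon (s.image fun z => z.2.1) (1 / ((n : ℝ) + 1)) (by positivity)
    obtain ⟨a, ha⟩ := hp (s.image (fun z => z.2.2.1) ∪ s.image (fun z => z.2.2.2))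
      (1 / ((n : ℝ) + 1)) (by positivity)
    exact ⟨(n, a, b, b'), hlt, fun z hz => ⟨hn z hz, hb _ (Finset.mem_image_of_mem _ hz),
      ha _ (Finset.mem_union_left _ (Finset.mem_image_of_mem (fun z => z.2.2.1) hz)),
      ha _ (Finset.mem_union_right _ (Finset.mem_image_of_mem (fun z => z.2.2.2) hz))⟩⟩)
  have hmono : StrictMono fun n => (g n).1 := fun m n h => (hrel m n h).1
  have hsmall : Tendsto (fun n => 1 / (((g n).1 : ℝ) + 1)) atTop (𝓝 0) :=
    tendsto_one_div_add_atTop_nhds_zero_nat.comp hmono.tendsto_atTop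
  have hrow (m : ℕ) :
      Tendsto (fun n => dist (f (g m).2.1 (g n).2.2.1) (f (g m).2.1 (g n).2.2.2)) atTop (𝓝 0) :=
    squeeze_zero' (Eventually.of_forall fun _ => dist_nonneg)
      ((eventually_gt_atTop m).mono fun n h => (hrel m n h).2.1) hsmall
  have hcol (m : ℕ) : Tendsto (fun n => f (g n).2.1 (g m).2.2.1) atTop (𝓝 (p (g m).2.2.1)) :=
    tendsto_iff_dist_tendsto_zero.2 (squeeze_zero' (Eventually.of_forall fun _ => dist_nonneg)
      ((eventually_gt_atTop m).mono fun n h => (hrel m n h).2.2.1.le) hsmall)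
  have hcol' (m : ℕ) : Tendsto (fun n => f (g n).2.1 (g m).2.2.2) atTop (𝓝 (p (g m).2.2.2)) :=
    tendsto_iff_dist_tendsto_zero.2 (squeeze_zero' (Eventually.of_forall fun _ => dist_nonneg)
      ((eventually_gt_atTop m).mono fun n h => (hrel m n h).2.2.2.le) hsmall)
  -- Sequential compactness of `(ℕ → I) × I × I` replaces a diagonal argument: one subsequence makes
  -- every row converge.
  obtain ⟨⟨t, r, r'⟩, ν, hν, hlim⟩ := CompactSpace.tendsto_subseq
    (fun n => ((fun m => f (g m).2.1 (g n).2.2.1 : ℕ → I), p (g n).2.2.1, p (g n).2.2.2))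
  rw [nhds_prod_eq, nhds_prod_eq, tendsto_prod_iff', tendsto_prod_iff'] at hlim
  obtain ⟨ht, hr, hr'⟩ := hlim
  rw [tendsto_pi_nhds] at ht
  have ht' (m : ℕ) : Tendsto (fun n => f (g m).2.1 (g (ν n)).2.2.2) atTop (𝓝 (t m)) :=
    tendsto_of_tendsto_of_dist (ht m) ((hrow m).comp hν.tendsto_atTop)
  -- The `a`'s are thinned along `κ` so that the row limits converge too; this leaves the column
  -- limits unchanged.
  obtain ⟨l, κ, hκ, hl⟩ := CompactSpace.tendsto_subseq t
  have h1 : l = r := hf (fun n => (g (κ n)).2.1) (fun n => (g (ν n)).2.2.1) l r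
    ⟨_, fun n => ht (κ n), hl⟩ ⟨_, fun m => (hcol (ν m)).comp hκ.tendsto_atTop, hr⟩
  have h2 : l = r' := hf (fun n => (g (κ n)).2.1) (fun n => (g (ν n)).2.2.2) l r'
    ⟨_, fun n => ht' (κ n), hl⟩ ⟨_, fun m => (hcol' (ν m)).comp hκ.tendsto_atTop, hr'⟩
  have h3 : ε ≤ dist r r' := ge_of_tendsto (hr.dist hr') (Eventually.of_forall fun n => (hg _).le)
  rw [← h1, ← h2, dist_self] at h3
  linarith

end DoubleLimitProperty

/-- A `[0,1]`-valued function which is determined up to `ε` by the values of `h` up to `δ` is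
within `ε` of a continuous function of `h`. -/
theorem exists_continuousMap_dist_le {B : Type y} {X : Type x} [PseudoMetricSpace X]
    {h : B → X} {p : B → I} {ε δ : ℝ} (hε : 0 ≤ ε) (hδ : 0 < δ)
    (H : ∀ b b', dist (h b) (h b') ≤ δ → dist (p b) (p b') ≤ ε) :
    ∃ c : C(X, I), ∀ b, dist (p b) (c (h b)) ≤ ε := by
  rcases isEmpty_or_nonempty B with hB | hB
  · exact ⟨ContinuousMap.const _ 0, fun b => hB.elim b⟩
  -- Infimal convolution with slope `δ⁻¹`: a point farther than `δ` pays a penalty of at least `1`,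
  -- so only points within `δ`, where `p` varies by at most `ε`, can lower the value.
  set F : X → ℝ := fun x => ⨅ b, ((p b : ℝ) + δ⁻¹ * dist x (h b)) with hF
  have hnn (x : X) (b : B) : 0 ≤ (p b : ℝ) + δ⁻¹ * dist x (h b) := by
    have := (p b).2.1; positivity
  have hbdd (x : X) : BddBelow (Set.range fun b => (p b : ℝ) + δ⁻¹ * dist x (h b)) :=
    ⟨0, by rintro _ ⟨b, rfl⟩; exact hnn x b⟩
  have hlip : LipschitzWith (Real.toNNReal δ⁻¹) F := by
    refine LipschitzWith.of_le_add_mul _ fun x x' => ?_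
    rw [Real.coe_toNNReal _ (inv_nonneg.2 hδ.le), ← sub_le_iff_le_add]
    refine le_ciInf fun b => ?_
    rw [sub_le_iff_le_add]
    refine (ciInf_le (hbdd x) b).trans ?_
    have := mul_le_mul_of_nonneg_left (dist_triangle x x' (h b)) (inv_nonneg.2 hδ.le)
    linarith
  refine ⟨⟨fun x => Set.projIcc 0 1 zero_le_one (F x),
    continuous_projIcc.comp hlip.continuous⟩, fun b => ?_⟩
  have hle : F (h b) ≤ p b := by
    refine (ciInf_le (hbdd _) b).trans ?_
    simp
  have hge : (p b : ℝ) - ε ≤ F (h b) := by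
    refine le_ciInf fun b' => ?_
    rcases le_total (dist (h b) (h b')) δ with hd | hd
    · have h1 := H b b' hd
      rw [Subtype.dist_eq, Real.dist_eq, abs_le] at h1
      have : 0 ≤ δ⁻¹ * dist (h b) (h b') := by positivity
      linarith
    · have h1 : 1 ≤ δ⁻¹ * dist (h b) (h b') := by
        rw [inv_mul_eq_div, le_div_iff₀ hδ]; linarith
      have := (p b).2.2
      have := (p b').2.1
      linarith
  have h0 : 0 ≤ F (h b) := Real.iInf_nonneg fun b' => hnn _ b'
  have hmem : F (h b) ∈ Set.Icc (0 : ℝ) 1 := ⟨h0, hle.trans (p b).2.2⟩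
  rw [ContinuousMap.coe_mk, Set.projIcc_of_mem _ hmem, Subtype.dist_eq, Real.dist_eq, abs_le]
  constructor <;> simp only <;> linarith

theorem DoubleLimitProperty.exists_continuousMap {A : Type x} {B : Type y} {f : A → B → I}
    {p : B → I} (hf : DoubleLimitProperty f)
    (hp : ∀ (s : Finset B) (ε : ℝ), 0 < ε → ∃ a, ∀ b ∈ s, dist (f a b) (p b) < ε)
    {ε : ℝ} (hε : 0 < ε) :
    ∃ (k : ℕ) (a : Fin k → A) (c : C(Fin k → I, I)),
      ∀ b, dist (p b) (c fun i => f (a i) b) ≤ ε := by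
  obtain ⟨s, δ, hδ, H⟩ := hf.exists_finset_dist_le hp hε
  obtain ⟨c, hc⟩ := exists_continuousMap_dist_le
    (h := fun (b : B) (i : Fin s.card) => f (s.equivFin.symm i) b) hε.le hδ (p := p) (by
      intro b b' hd
      refine H b b' fun a ha => ?_
      simpa using (dist_pi_le_iff hδ.le).1 hd (s.equivFin ⟨a, ha⟩))
  exact ⟨s.card, fun i => s.equivFin.symm i, c, hc⟩

/-- Uniform approximation on a dense set of a function by continuous functions yields an extension
which is approximated on the whole space. -/
theorem DenseRange.exists_extension_of_dist_le {B : Type y} {S : Type x} [TopologicalSpace S]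
    {r : B → S} (hr : DenseRange r) {p : B → I} (F : ℕ → S → I) (hF : ∀ n, Continuous (F n))
    (hp : ∀ n b, dist (p b) (F n (r b)) ≤ 1 / ((n : ℝ) + 1)) :
    ∃ ψ : S → I, (∀ n q, dist (ψ q) (F n q) ≤ 1 / ((n : ℝ) + 1)) ∧ ∀ b, p b = ψ (r b) := by
  -- The bound is a closed condition on `q` and holds on the dense range, hence everywhere.
  have hdist (m n : ℕ) (q : S) :
      dist (F m q) (F n q) ≤ 1 / ((m : ℝ) + 1) + 1 / ((n : ℝ) + 1) := by
    refine hr.induction_on (p := fun q => dist (F m q) (F n q) ≤ _) q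
      (isClosed_le ((hF m).dist (hF n)) continuous_const) fun b => ?_
    exact (dist_triangle_left _ _ (p b)).trans (add_le_add (hp m b) (hp n b))
  have hzero : Tendsto (fun n : ℕ => 1 / ((n : ℝ) + 1)) atTop (𝓝 0) :=
    tendsto_one_div_add_atTop_nhds_zero_nat
  have hlim (q : S) : ∃ l, Tendsto (fun n => F n q) atTop (𝓝 l) := by
    refine cauchySeq_tendsto_of_complete (cauchySeq_of_le_tendsto_0
      (fun n : ℕ => 1 / ((n : ℝ) + 1) + 1 / ((n : ℝ) + 1)) (fun n m N hn hm => ?_)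
      (by simpa using hzero.add hzero))
    exact (hdist n m q).trans (add_le_add (Nat.one_div_le_one_div hn) (Nat.one_div_le_one_div hm))
  choose ψ hψ using hlim
  refine ⟨ψ, fun n q => ?_, fun b => ?_⟩
  · refine le_of_tendsto_of_tendsto ((hψ q).dist tendsto_const_nhds)
      (by simpa using hzero.add_const (1 / ((n : ℝ) + 1))) (Eventually.of_forall fun m => ?_)
    simpa only [one_div] using hdist m n q
  · refine tendsto_nhds_unique ?_ (hψ (r b))
    exact tendsto_iff_dist_tendsto_zero.2 (squeeze_zero (fun _ => dist_nonneg)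
      (fun n => by rw [dist_comm]; exact hp n b) hzero)

/-! ### Definability of types in continuous logic -/

namespace MetricLanguage

variable {L : MetricLanguage.{u, v}} {α : Type x} {β : Type y}

/-! ### Turning free variables into quantified ones -/

section Semantics

variable {M : Type w}

/-- The renaming of variables underlying `BoundedFormula.bind`. -/
def bindVar {m : ℕ} (g : α → β ⊕ Fin m) (n : ℕ) : α ⊕ Fin n → β ⊕ Fin (m + n) :=
  Sum.elim (fun i => Sum.map id (Fin.castAdd n) (g i)) (fun i => Sum.inr (Fin.natAdd m i))

theorem elim_comp_bindVar {m : ℕ} (g : α → β ⊕ Fin m) (n : ℕ) (e : β → M) (xs : Fin (m + n) → M) :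
    Sum.elim e xs ∘ bindVar g n =
      Sum.elim (fun i => Sum.elim e (xs ∘ Fin.castAdd n) (g i)) (xs ∘ Fin.natAdd m) := by
  funext i
  rcases i with i | i
  · simp only [bindVar, Function.comp_apply, Sum.elim_inl]
    cases g i <;> rfl
  · rfl

theorem snoc_comp_castAdd_succ {m n : ℕ} (xs : Fin (m + n) → M) (a : M) :
    (Fin.snoc xs a : Fin (m + (n + 1)) → M) ∘ Fin.castAdd (n + 1) = xs ∘ Fin.castAdd n := by
  funext i
  exact Fin.snoc_castSucc (α := fun _ => M) a xs (Fin.castAdd n i)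

theorem snoc_comp_natAdd {m n : ℕ} (xs : Fin (m + n) → M) (a : M) :
    (Fin.snoc xs a : Fin (m + (n + 1)) → M) ∘ Fin.natAdd m = Fin.snoc (xs ∘ Fin.natAdd m) a := by
  funext i
  refine Fin.lastCases ?_ (fun i => ?_) i
  · rw [Fin.snoc_last]
    exact Fin.snoc_last (α := fun _ => M) a xs
  · rw [Fin.snoc_castSucc]
    exact Fin.snoc_castSucc (α := fun _ => M) a xs (Fin.natAdd m i)

variable [MetricSpace M] [L.Structure M]

theorem Term.realize_relabel (g : α → β) (e : β → M) (t : L.Term α) :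
    (t.relabel g).realize e = t.realize (e ∘ g) := by
  induction t with
  | var i => rfl
  | func f ts ih => simp only [Term.relabel, Term.realize, ih]

theorem BoundedFormula.value_relabel (g : α → β) (e : β → M) {n : ℕ} (φ : L.BoundedFormula α n)
    (xs : Fin n → M) : (φ.relabel g).value e xs = φ.value (e ∘ g) xs := by
  induction φ with
  | dist s t =>
    simp only [BoundedFormula.relabel, BoundedFormula.value, Term.realize_relabel,
      Sum.elim_comp_map, Function.comp_id]
  | rel R ts =>
    simp only [BoundedFormula.relabel, BoundedFormula.value, Term.realize_relabel,
      Sum.elim_comp_map, Function.comp_id]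
  | conn c φs ih => simp only [BoundedFormula.relabel, BoundedFormula.value, ih]
  | inf φ ih => simp only [BoundedFormula.relabel, BoundedFormula.value, ih]
  | sup φ ih => simp only [BoundedFormula.relabel, BoundedFormula.value, ih]

theorem Formula.val_swap (φ : L.Formula (α ⊕ β)) (a : α → M) (b : β → M) :
    φ.swap.val (Sum.elim b a) = φ.val (Sum.elim a b) := by
  unfold Formula.val Formula.swap
  rw [BoundedFormula.value_relabel]
  congr 1
  funext i; cases i <;> rfl

/-- Renaming of the free variables of a formula which turns some of them into variables available
for quantification. -/
def BoundedFormula.bind {m : ℕ} (g : α → β ⊕ Fin m) :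
    {n : ℕ} → L.BoundedFormula α n → L.BoundedFormula β (m + n)
  | n, .dist s t => .dist (s.relabel (bindVar g n)) (t.relabel (bindVar g n))
  | n, .rel R ts => .rel R (fun i => (ts i).relabel (bindVar g n))
  | _, .conn c φs => .conn c (fun i => (φs i).bind g)
  -- `m + (n + 1)` is `(m + n) + 1` by definition, and the `m` new variables come first, so the
  -- quantifier still binds the last one.
  | _, .inf φ => .inf (φ.bind g)
  | _, .sup φ => .sup (φ.bind g)

theorem BoundedFormula.value_bind {m : ℕ} (g : α → β ⊕ Fin m) (e : β → M) {n : ℕ}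
    (φ : L.BoundedFormula α n) (xs : Fin (m + n) → M) :
    (φ.bind g).value e xs =
      φ.value (fun i => Sum.elim e (xs ∘ Fin.castAdd n) (g i)) (xs ∘ Fin.natAdd m) := by
  induction φ with
  | dist s t =>
    simp only [BoundedFormula.bind, BoundedFormula.value, Term.realize_relabel, elim_comp_bindVar]
  | rel R ts =>
    simp only [BoundedFormula.bind, BoundedFormula.value, Term.realize_relabel, elim_comp_bindVar]
  | conn c φs ih => simp only [BoundedFormula.bind, BoundedFormula.value, ih]
  | inf φ ih =>
    simp only [BoundedFormula.bind, BoundedFormula.value]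
    refine iInf_congr fun a => ?_
    rw [← snoc_comp_natAdd, ← snoc_comp_castAdd_succ xs a]
    exact ih _
  | sup φ ih =>
    simp only [BoundedFormula.bind, BoundedFormula.value]
    refine iSup_congr fun a => ?_
    rw [← snoc_comp_natAdd, ← snoc_comp_castAdd_succ xs a]
    exact ih _

/-- The infimum of a formula over all variables available for quantification. -/
def BoundedFormula.infs : {n : ℕ} → L.BoundedFormula α n → L.Formula α
  | 0, φ => φ
  | _ + 1, φ => φ.inf.infs

/-- The inequality is strict because an infimum need not be attained. -/
theorem BoundedFormula.val_infs_lt_iff (e : α → M) (r : I) {n : ℕ} (φ : L.BoundedFormula α n) :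
    φ.infs.val e < r ↔ ∃ xs : Fin n → M, φ.value e xs < r := by
  induction n with
  | zero =>
    refine ⟨fun h => ⟨Fin.elim0, h⟩, fun ⟨xs, h⟩ => ?_⟩
    rwa [Subsingleton.elim xs Fin.elim0] at h
  | succ n ih =>
    rw [BoundedFormula.infs, ih]
    simp only [BoundedFormula.value, iInf_lt_iff]
    refine ⟨fun ⟨xs, a, h⟩ => ⟨_, h⟩, fun ⟨xs, h⟩ => ⟨Fin.init xs, xs (Fin.last n), ?_⟩⟩
    rwa [Fin.snoc_init_self]

end Semantics

/-! ### Density of realized types and definability -/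

section Types

/-- The type of a tuple of an elementary extension is approximated on finitely many parameters by
types of tuples of the structure. -/
theorem ElementaryEmbedding.exists_forall_dist_lt [Finite α] [Finite β] {M : Type w}
    {N : Type w'} [MetricSpace M] [L.Structure M] [MetricSpace N] [L.Structure N]
    (j : L.ElementaryEmbedding M N) (φ : L.Formula (α ⊕ β)) (a : α → N)
    (s : Finset (β → M)) {ε : ℝ} (hε : 0 < ε) :
    ∃ a' : α → M, ∀ b ∈ s,
      dist (φ.val (Sum.elim a' b)) (φ.val (Sum.elim a (j.toFun ∘ b))) < ε := by
  obtain ⟨m, ⟨eα⟩⟩ := Finite.exists_equiv_fin α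
  obtain ⟨K, ⟨eβ⟩⟩ := Finite.exists_equiv_fin (s × β)
  let t : Fin s.card → I := fun i => φ.val (Sum.elim a (j.toFun ∘ s.equivFin.symm i))
  -- The connective is the maximum distance to the target values `t`. Thus `θ` measures how far a
  -- tuple is from having the type of `a` on `s`; its infimum is `0` in `N`, hence also in `M`.
  let c : C(Fin s.card → I, I) := ⟨fun z => ⟨dist z t, dist_nonneg,
    (dist_pi_le_iff zero_le_one).2 fun i => Real.dist_le_of_mem_Icc_01 (z i).2 (t i).2⟩,
    by fun_prop⟩
  let g (i : Fin s.card) : α ⊕ β → Fin K ⊕ Fin m :=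
    Sum.elim (fun i => Sum.inr (eα i)) (fun l => Sum.inl (eβ (s.equivFin.symm i, l)))
  let θ : L.BoundedFormula (Fin K) m := .conn c fun i => BoundedFormula.bind (g i) φ
  let e : Fin K → M := fun l => (eβ.symm l).1.1 (eβ.symm l).2
  -- Truncated at `1` because thresholds for values of formulas lie in `I`.
  let δ : I := ⟨min ε 1, by positivity, min_le_right _ _⟩
  have hδ : 0 < δ := by
    rw [← Subtype.coe_lt_coe]
    exact lt_min hε one_pos
  have hN : θ.infs.val (j.toFun ∘ e) < δ := by
    refine (BoundedFormula.val_infs_lt_iff _ _ _).2 ⟨a ∘ eα.symm, ?_⟩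
    suffices h : (fun i => (BoundedFormula.bind (g i) φ).value (j.toFun ∘ e) (a ∘ eα.symm)) = t by
      have h0 : θ.value (j.toFun ∘ e) (a ∘ eα.symm) = 0 := by
        change c _ = 0
        rw [h]
        exact Subtype.ext (dist_self t)
      rwa [h0]
    funext i
    refine (BoundedFormula.value_bind (g i) _ φ (a ∘ eα.symm)).trans ?_
    have : (fun l => Sum.elim (j.toFun ∘ e) ((a ∘ eα.symm) ∘ Fin.castAdd 0) (g i l)) =
        Sum.elim a (j.toFun ∘ s.equivFin.symm i) := by
      funext l
      rcases l with l | l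
      · exact congrArg a (eα.symm_apply_apply l)
      · simp [g, e]
    rw [this, Subsingleton.elim ((a ∘ eα.symm) ∘ Fin.natAdd m) Fin.elim0]
    rfl
  rw [j.val_comp, BoundedFormula.val_infs_lt_iff] at hN
  obtain ⟨xs, hxs⟩ := hN
  refine ⟨xs ∘ eα, fun b hb => ?_⟩
  have hlt : dist (fun i => (BoundedFormula.bind (g i) φ).value e xs) t < ε :=
    lt_of_lt_of_le (b := (δ : ℝ)) hxs (min_le_left _ _)
  have h := (dist_le_pi_dist _ _ (s.equivFin ⟨b, hb⟩)).trans_lt hlt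
  have hv : (BoundedFormula.bind (g (s.equivFin ⟨b, hb⟩)) φ).value e xs =
      φ.val (Sum.elim (xs ∘ eα) b) := by
    refine (BoundedFormula.value_bind _ e φ xs).trans ?_
    have : (fun l => Sum.elim e (xs ∘ Fin.castAdd 0) (g (s.equivFin ⟨b, hb⟩) l)) =
        Sum.elim (xs ∘ eα) b := by
      funext l
      rcases l with l | l
      · rfl
      · simp [g, e]
    rw [this, Subsingleton.elim (xs ∘ Fin.natAdd m) Fin.elim0]
    rfl
  rw [hv] at h
  simpa [t] using h

variable {M : Type w} [MetricSpace M] [L.Structure M]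

theorem Formula.continuous_apply_types {φ : L.Formula (α ⊕ β)} {k : ℕ} (b : Fin k → β → M)
    (c : C(Fin k → I, I)) : Continuous fun p : φ.types M => c fun i => p.1 (b i) :=
  c.continuous.comp (continuous_pi fun i => (continuous_apply (b i)).comp continuous_subtype_val)

theorem Formula.IsPredicate.continuous {φ : L.Formula (α ⊕ β)} {ψ : φ.types M → I}
    (hψ : φ.IsPredicate ψ) : Continuous ψ := by
  refine continuous_of_uniform_approx_of_continuous fun u hu => ?_
  obtain ⟨ε, hε, hu⟩ := Metric.mem_uniformity_dist.1 hu
  obtain ⟨k, b, c, h⟩ := hψ (ε / 2) (half_pos hε)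
  exact ⟨_, continuous_apply_types b c, fun p => hu ((h p).trans_lt (half_lt_self hε))⟩

variable [Finite α] [Finite β]

theorem Formula.exists_forall_dist_lt_of_mem_types {φ : L.Formula (α ⊕ β)} (p : φ.types M)
    (s : Finset (β → M)) {ε : ℝ} (hε : 0 < ε) :
    ∃ a : α → M, ∀ b ∈ s, dist (φ.val (Sum.elim a b)) (p.1 b) < ε := by
  obtain ⟨_, N, _, _, _, j, a, rfl⟩ := p
  exact j.exists_forall_dist_lt φ a s hε

/-- The topology is pointwise convergence, whose basic neighbourhoods constrain finitely many
parameters; density is thus finite satisfiability. -/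
theorem Formula.denseRange_realizedType [CompleteSpace M] (φ : L.Formula (α ⊕ β)) :
    DenseRange (φ.realizedType (M := M)) := by
  intro p
  rw [mem_closure_iff_nhds]
  intro U hU
  rw [nhds_subtype_eq_comap, mem_comap] at hU
  obtain ⟨V, hV, hVU⟩ := hU
  rw [nhds_pi, Filter.mem_pi] at hV
  obtain ⟨s, hs, W, hW, hWV⟩ := hV
  have (b : β → M) : ∃ ε > 0, Metric.ball (p.1 b) ε ⊆ W b := Metric.mem_nhds_iff.1 (hW b)
  choose ε hε hball using this
  obtain ⟨δ, hδ, hle⟩ : ∃ δ > 0, ∀ b ∈ hs.toFinset, δ ≤ ε b := by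
    rcases hs.toFinset.eq_empty_or_nonempty with h | h
    · exact ⟨1, one_pos, by simp [h]⟩
    · exact ⟨hs.toFinset.inf' h ε, (Finset.lt_inf'_iff h).2 fun b _ => hε b,
        fun b hb => Finset.inf'_le _ hb⟩
  obtain ⟨a, ha⟩ := exists_forall_dist_lt_of_mem_types p hs.toFinset hδ
  refine ⟨φ.realizedType a, hVU (hWV fun b hb => hball b ?_), a, rfl⟩
  have hb' := hs.mem_toFinset.2 hb
  exact (ha b hb').trans_le (hle b hb')

/-- Definability of `φ`-types in continuous logic. -/
theorem Formula.IsStableIn.existsUnique_isPredicate_defines [CompleteSpace M]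
    {φ : L.Formula (α ⊕ β)} (hφ : φ.IsStableIn M) (p : φ.types M) :
    ∃! ψ : φ.swap.types M → I, φ.swap.IsPredicate ψ ∧ φ.Defines ψ p := by
  have hdense := φ.swap.denseRange_realizedType (M := M)
  have happ (n : ℕ) := hφ.exists_continuousMap (p := p.1)
    (fun s ε hε => exists_forall_dist_lt_of_mem_types p s hε)
    (Nat.one_div_pos_of_nat (α := ℝ) (n := n))
  choose k a c hc using happ
  obtain ⟨ψ, hψ, hdef⟩ := hdense.exists_extension_of_dist_le (p := p.1)
    (fun n q => c n fun i => q.1 (a n i)) (fun n => continuous_apply_types (a n) (c n))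
    (fun n b => by
      refine le_of_eq_of_le ?_ (hc n b)
      congr 2
      funext i
      exact φ.val_swap (a n i) b)
  have hpred : φ.swap.IsPredicate ψ := fun ε hε => by
    obtain ⟨n, hn⟩ := exists_nat_one_div_lt hε
    exact ⟨k n, a n, c n, fun q => (hψ n q).trans hn.le⟩
  exact ⟨ψ, ⟨hpred, hdef⟩, fun χ ⟨hχ, hχp⟩ => hdense.equalizer hχ.continuous hpred.continuous
    (funext fun b => (hχp b).symm.trans (hdef b))⟩

end Types

end MetricLanguage

/-! ### Definability of types in classical logic -/

namespace ClassicalLocalTypes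

open FirstOrder FirstOrder.Language

variable {L : FirstOrder.Language.{u, v}} {α : Type x} {β : Type y}

theorem truthValue_congr {P Q : Prop} (h : P ↔ Q) : truthValue P = truthValue Q := by
  rw [propext h]

theorem iff_of_dist_truthValue_lt {P Q : Prop} (h : dist (truthValue P) (truthValue Q) < 1) :
    P ↔ Q := by
  by_cases hP : P <;> by_cases hQ : Q <;>
    simp_all [truthValue, Subtype.dist_eq]

/-- The type of a tuple of an elementary extension is finitely satisfiable in the structure. -/
theorem exists_realize_iff_mem [Finite α] {φ : L.Formula (α ⊕ β)} {M : Type w}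
    [L.Structure M] {p : Set (β → M)} (hp : p ∈ types φ M) (s : Finset (β → M)) :
    ∃ a : α → M, ∀ b ∈ s, φ.Realize (Sum.elim a b) ↔ b ∈ p := by
  classical
  obtain ⟨N, _, j, a, rfl⟩ := hp
  -- The variable `(b, l)` stands for the entry `l` of the parameter `b`. The variables in `α` are
  -- left to be quantified existentially.
  let g (b : s) : α ⊕ β → (s × β) ⊕ α := Sum.elim Sum.inr fun l => Sum.inl (b, l)
  let θ (b : s) : L.Formula ((s × β) ⊕ α) :=
    if φ.Realize (Sum.elim a (j ∘ b.1)) then φ.relabel (g b) else (φ.relabel (g b)).not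
  let e : s × β → M := fun z => z.1.1 z.2
  have hgM (a' : α → M) (b : s) : Sum.elim e a' ∘ g b = Sum.elim a' b := by
    funext l; cases l <;> rfl
  have hgN (b : s) : Sum.elim (j ∘ e) a ∘ g b = Sum.elim a (j ∘ b.1) := by
    funext l; cases l <;> rfl
  have hN : (Formula.iExs α (Formula.iInf θ)).Realize (j ∘ e) := by
    rw [Formula.realize_iExs]
    refine ⟨a, Formula.realize_iInf.2 fun b => ?_⟩
    by_cases h : φ.Realize (Sum.elim a (j ∘ b.1))
    · simp only [θ, h, if_true, Formula.realize_relabel, hgN]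
    · simp only [θ, h, if_false, Formula.realize_not, Formula.realize_relabel, hgN]
      exact not_false
  rw [j.map_formula, Formula.realize_iExs] at hN
  obtain ⟨a', ha'⟩ := hN
  rw [Formula.realize_iInf] at ha'
  refine ⟨a', fun b hb => ?_⟩
  have hb' := ha' ⟨b, hb⟩
  rw [Set.mem_ofPred_eq]
  by_cases h : φ.Realize (Sum.elim a (j ∘ b))
  · simp only [θ, h, if_true, Formula.realize_relabel, hgM] at hb'
    exact iff_of_true hb' h
  · simp only [θ, h, if_false, Formula.realize_not, Formula.realize_relabel, hgM] at hb'
    exact iff_of_false hb' h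

theorem realize_inst {M : Type w} [L.Structure M] (φ : L.Formula (α ⊕ β)) (b : β → M)
    (a : α → M) : (inst φ b).Realize a ↔ φ.Realize (Sum.elim a b) := by
  unfold inst Formula.Realize
  rw [BoundedFormula.realize_subst]
  refine (LHom.realize_onFormula (L.lhomWithConstants M) φ).trans (iff_of_eq ?_)
  congr 1
  funext i
  rcases i with i | i
  · rfl
  · exact Term.realize_constants

theorem IsLocalFormula.iInf {M : Type w} {φ : L.Formula (α ⊕ β)} {ι : Type w'} [Finite ι]
    {ψ : ι → L[[M]].Formula α} (h : ∀ i, IsLocalFormula φ (ψ i)) :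
    IsLocalFormula φ (Formula.iInf ψ) := by
  unfold Formula.iInf BoundedFormula.iInf
  dsimp only
  generalize (@Finset.univ ι (Fintype.ofFinite ι)).toList = l
  induction l with
  -- The empty conjunction `⊤` is by definition the negation of `⊥`.
  | nil => exact .not .bot
  | cons i l ih => exact .inf (h i) ih

theorem IsLocalFormula.iSup {M : Type w} {φ : L.Formula (α ⊕ β)} {ι : Type w'} [Finite ι]
    {ψ : ι → L[[M]].Formula α} (h : ∀ i, IsLocalFormula φ (ψ i)) :
    IsLocalFormula φ (Formula.iSup ψ) := by
  unfold Formula.iSup BoundedFormula.iSup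
  dsimp only
  generalize (@Finset.univ ι (Fintype.ofFinite ι)).toList = l
  induction l with
  | nil => exact .bot
  | cons i l ih => exact .sup (h i) ih

/-- A set which is determined by finitely many instances is defined by a local formula. -/
theorem exists_isLocalFormula_defines {M : Type w} [L.Structure M] {φ : L.Formula (α ⊕ β)}
    {p : Set (α → M)} (s : Finset (β → M))
    (hs : ∀ a a' : α → M, (∀ b ∈ s, φ.Realize (Sum.elim a b) ↔ φ.Realize (Sum.elim a' b)) →
      a ∈ p → a' ∈ p) :
    ∃ ψ : L[[M]].Formula α, IsLocalFormula φ ψ ∧ Defines ψ p := by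
  classical
  -- The truth patterns on `s` that occur in `p`. There are finitely many, and `p` is defined by the
  -- disjunction of their descriptions.
  let ι := {t : s → Prop // ∃ a ∈ p, ∀ b : s, t b ↔ φ.Realize (Sum.elim a b.1)}
  let θ (t : ι) (b : s) : L[[M]].Formula α := if t.1 b then inst φ b.1 else (inst φ b.1).not
  have hθ (t : ι) (b : s) (a : α → M) :
      (θ t b).Realize a ↔ (t.1 b ↔ φ.Realize (Sum.elim a b.1)) := by
    by_cases h : t.1 b
    · simp only [θ, h, if_true, realize_inst, true_iff]
    · simp only [θ, h, if_false, Formula.realize_not, realize_inst, false_iff]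
  refine ⟨Formula.iSup fun t => Formula.iInf (θ t), .iSup fun t => .iInf fun b => ?_,
    fun a => ?_⟩
  · by_cases h : t.1 b
    · simpa only [θ, h, if_true] using IsLocalFormula.inst b.1
    · simpa only [θ, h, if_false] using (IsLocalFormula.inst b.1).not
  · simp only [Formula.realize_iSup, Formula.realize_iInf, hθ]
    constructor
    · exact fun ha => ⟨⟨fun b => φ.Realize (Sum.elim a b.1), a, ha, fun _ => Iff.rfl⟩,
        fun _ => Iff.rfl⟩
    · rintro ⟨⟨t, a', ha', ht⟩, h⟩
      exact hs a' a (fun b hb => (ht ⟨b, hb⟩).symm.trans (h ⟨b, hb⟩)) ha'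

/-- Formulas over `M` which agree in `M` are equivalent modulo the elementary diagram. -/
theorem elementaryDiagram_iff [Finite β] {M : Type w} [L.Structure M] {ψ χ : L[[M]].Formula β}
    (h : ∀ b : β → M, ψ.Realize b ↔ χ.Realize b) : (L.elementaryDiagram M).Iff ψ χ := by
  intro N v xs
  let θ : L[[M]].Sentence := Formula.iAlls β ((ψ.iff χ).relabel Sum.inr)
  have hθ : θ ∈ L.elementaryDiagram M := by
    rw [elementaryDiagram, mem_completeTheory]
    refine Formula.realize_iAlls.2 fun b => Formula.realize_relabel.2 ?_
    exact Formula.realize_iff.2 (h b)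
  have hN := Formula.realize_iAlls.1 (Theory.realize_sentence_of_mem (M := N) _ hθ) v
  rw [Subsingleton.elim xs default]
  exact (Formula.realize_relabel (φ := ψ.iff χ) (g := Sum.inr)).1 hN

/-- Definability of `φ`-types in classical logic. -/
theorem IsStableIn.exists_isLocalFormula_defines [Finite α] {φ : L.Formula (α ⊕ β)} {M : Type w}
    [L.Structure M] (hφ : IsStableIn φ M) {p : Set (β → M)} (hp : p ∈ types φ M) :
    ∃ ψ : L[[M]].Formula β, IsLocalFormula (φ.relabel Sum.swap) ψ ∧ Defines ψ p := by
  have hswap (a : α → M) (b : β → M) :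
      (φ.relabel Sum.swap).Realize (Sum.elim b a) ↔ φ.Realize (Sum.elim a b) := by
    rw [Formula.realize_relabel]
    refine iff_of_eq (congrArg _ ?_)
    funext i; cases i <;> rfl
  -- Any `ε < 1` would do, since truth values at distance less than `1` are equal.
  obtain ⟨s, δ, hδ, H⟩ := DoubleLimitProperty.exists_finset_dist_le hφ
    (p := fun b => truthValue (b ∈ p)) (fun t ε hε => by
      obtain ⟨a, ha⟩ := exists_realize_iff_mem hp t
      refine ⟨a, fun b hb => ?_⟩
      rwa [truthValue_congr (ha b hb), dist_self]) one_half_pos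
  refine ClassicalLocalTypes.exists_isLocalFormula_defines s fun b b' h => ?_
  refine (iff_of_dist_truthValue_lt ((H b b' fun a ha => ?_).trans_lt one_half_lt_one)).1
  have := h a ha
  rw [hswap, hswap] at this
  rw [truthValue_congr this, dist_self]
  exact hδ.le

end ClassicalLocalTypes

theorem mainTheorem1 :
    (∀ (L : MetricLanguage.{u, v}) (M : Type w) [MetricSpace M] [CompleteSpace M] [Nonempty M]
      [L.Structure M] (α : Type x) (β : Type y) [Finite α] [Finite β] (φ : L.Formula (α ⊕ β)),
      φ.IsStableIn M → ∀ p : φ.types M,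
        ∃! ψ : φ.swap.types M → unitInterval, φ.swap.IsPredicate ψ ∧ φ.Defines ψ p) ∧
    (∀ (L : FirstOrder.Language.{u, v}) (M : Type w) [Nonempty M] [L.Structure M]
      (α : Type x) (β : Type y) [Finite α] [Finite β] (φ : L.Formula (α ⊕ β)),
      ClassicalLocalTypes.IsStableIn φ M → ∀ p ∈ ClassicalLocalTypes.types φ M,
        ∃ ψ : (L.withConstants M).Formula β,
          ClassicalLocalTypes.IsLocalFormula (φ.relabel Sum.swap) ψ ∧
          ClassicalLocalTypes.Defines ψ p ∧
          ∀ χ : (L.withConstants M).Formula β,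
            ClassicalLocalTypes.IsLocalFormula (φ.relabel Sum.swap) χ →
            ClassicalLocalTypes.Defines χ p →
            (L.elementaryDiagram M).Iff ψ χ) := by
  refine ⟨?_, ?_⟩
  · intro L M _ _ _ _ α β _ _ φ hφ p
    exact hφ.existsUnique_isPredicate_defines p
  · intro L M _ _ α β _ _ φ hφ p hp
    obtain ⟨ψ, hψ, hdef⟩ := hφ.exists_isLocalFormula_defines hp
    exact ⟨ψ, hψ, hdef, fun χ _ hχ =>
      ClassicalLocalTypes.elementaryDiagram_iff fun b => (hdef b).symm.trans (hχ b)⟩
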